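/- Let $A$ and $X$ be arbitrary sets and let $R\subseteq A\times X$ be a relation. Let $D_A$ be the Dowker complex with base $A$, i.e. the abstract simplicial complex whose simplices are the nonempty finite subsets $\sigma\subseteq A$ for which there exists $x\in X$ with $\sigma\times\{x\}\subseteq R$; and let $D_X$ be the Dowker complex with base $X$, whose simplices are the nonempty finite subsets $\tau\subseteq X$ for which there exists $a\in A$ with $\{a\}\times\tau\subseteq R$. Then the geometric realizations of $D_A$ and $D_X$ (with the weak topology) are homotopy equivalent: $D_A\simeq D_X$. -/

import Mathlib

open scoped ContinuousMap

universe u v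

/-- The Dowker complex with base `A` of a relation `R ⊆ A × X`: its simplices are the (nonempty)
finite subsets `σ` of `A` all of whose elements are related to a common element `x` of `X`. -/
def dowkerComplex {A : Type u} {X : Type v} (R : SetRel A X) : PreAbstractSimplicialComplex A where
  faces := {σ | σ.Nonempty ∧ ∃ x : X, ∀ a ∈ σ, (a, x) ∈ R}
  isRelLowerSet_faces := by
    rintro σ ⟨hσ, x, hx⟩
    exact ⟨hσ, fun τ hτ hne => ⟨hne, x, fun a ha => hx a (hτ ha)⟩⟩

/-- The underlying set of the geometric realization of an abstract simplicial complex `K`: formal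
convex combinations of vertices (barycentric coordinates) whose support is a simplex of `K`. -/
def Realization {V : Type u} (K : PreAbstractSimplicialComplex V) : Type u :=
  {t : V →₀ ℝ // (∀ v, 0 ≤ t v) ∧ (t.sum fun _ r => r) = 1 ∧ t.support ∈ K.faces}

/-- The inclusion of the closed simplex spanned by a simplex `σ` of `K` into the geometric
realization of `K`: barycentric coordinates on `σ` are extended by zero. -/
noncomputable def Realization.ofSimplex {V : Type u} (K : PreAbstractSimplicialComplex V)
    (σ : K.faces) (p : stdSimplex ℝ (σ : Finset V)) : Realization K :=
  ⟨Finsupp.embDomain (Function.Embedding.subtype _) (Finsupp.equivFunOnFinite.symm p.1), by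
    have hsum : ((Finsupp.embDomain (Function.Embedding.subtype (· ∈ (σ : Finset V)))
        (Finsupp.equivFunOnFinite.symm p.1)).sum fun _ r => r) = 1 := by
      rw [Finsupp.sum_embDomain, Finsupp.sum_fintype _ _ (fun _ => rfl)]
      exact p.2.2
    refine ⟨fun v => ?_, hsum, (K.isRelLowerSet_faces σ.2).2 ?_ ?_⟩
    · by_cases hv : v ∈ (σ : Finset V)
      · have h := Finsupp.embDomain_apply_self
          (Function.Embedding.subtype (· ∈ (σ : Finset V)))
          (Finsupp.equivFunOnFinite.symm p.1) ⟨v, hv⟩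
        rw [Function.Embedding.subtype_apply] at h
        rw [h]
        exact p.2.1 ⟨v, hv⟩
      · rw [Finsupp.embDomain_of_notMem_range]
        rintro ⟨w, rfl⟩
        exact hv w.2
    · intro v hv
      rw [Finsupp.support_embDomain, Finset.mem_map] at hv
      obtain ⟨w, -, rfl⟩ := hv
      exact w.2
    · rw [Finset.nonempty_iff_ne_empty, Ne, Finsupp.support_eq_empty]
      intro h0
      rw [h0, Finsupp.sum_zero_index] at hsum
      exact zero_ne_one hsum⟩

/-- The weak (coherent) topology on the geometric realization: a set is open if and only if its
intersection with every closed simplex is open in that simplex (with its Euclidean topology). -/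
noncomputable instance Realization.instTopologicalSpace {V : Type u} (K : PreAbstractSimplicialComplex V) :
    TopologicalSpace (Realization K) :=
  ⨆ σ : K.faces, TopologicalSpace.coinduced (Realization.ofSimplex K σ) inferInstance

/-! Both Dowker complexes sit in `jointComplex R` on the disjoint union of `A` and `X`. The
realization with base `X` is a deformation retract of it; the swap of `A` and `X` gives the same for
base `A`, and the equivalences compose.

The retraction is a layer-cake decomposition. Choose a witness `x σ` for each simplex `σ` on the `A`
side. At time `c`, cut the `A`-weights `u` down to `u - c`, and send each level `s < c` to the
witness of the superlevel set of `u` at `s`; then normalize, since total mass is not preserved.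
Superlevel sets are nested: those below `c` contain every vertex surviving the cut, and all nonempty
ones contain the maximizers of `u`. Hence the support stays a simplex
(`support_pushVector_mem_faces`). At time 1 no `A`-mass is left. Joint continuity
(`continuous_push`) is checked on closed simplices times the interval, by `continuous_prod_iff`. -/

open scoped NNReal

/-! ### Continuity for the weak topology -/

namespace Realization

variable {V : Type*} {W : Type*} {K : PreAbstractSimplicialComplex V}
  {L : PreAbstractSimplicialComplex W}

theorem ofSimplex_apply (σ : K.faces) (p : stdSimplex ℝ (σ : Finset V)) (v : V)
    [Decidable (v ∈ (σ : Finset V))] :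
    (ofSimplex K σ p).1 v = if h : v ∈ (σ : Finset V) then p.1 ⟨v, h⟩ else 0 := by
  unfold ofSimplex
  split_ifs with h
  · exact Finsupp.embDomain_apply_self (Function.Embedding.subtype (· ∈ (σ : Finset V)))
      (Finsupp.equivFunOnFinite.symm p.1) ⟨v, h⟩
  · apply Finsupp.embDomain_of_notMem_range
    rintro ⟨w, rfl⟩
    exact h w.2

theorem support_ofSimplex_subset (σ : K.faces) (p : stdSimplex ℝ (σ : Finset V)) :
    (ofSimplex K σ p).1.support ⊆ (σ : Finset V) := by
  classical
  intro v hv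
  by_contra h
  rw [Finsupp.mem_support_iff, ofSimplex_apply, dif_neg h] at hv
  exact hv rfl

theorem continuous_ofSimplex (σ : K.faces) : Continuous (ofSimplex K σ) :=
  continuous_iff_coinduced_le.2 (le_iSup (fun σ : K.faces =>
    TopologicalSpace.coinduced (ofSimplex K σ) inferInstance) σ)

theorem continuous_iff_forall_ofSimplex {T : Type*} [TopologicalSpace T] {f : Realization K → T} :
    Continuous f ↔ ∀ σ : K.faces, Continuous (f ∘ ofSimplex K σ) := by
  simp only [continuous_iSup_dom, continuous_coinduced_dom]

theorem continuous_apply (v : V) : Continuous fun p : Realization K => p.1 v := by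
  classical
  refine continuous_iff_forall_ofSimplex.2 fun σ => ?_
  simp only [Function.comp_def, ofSimplex_apply]
  split_ifs with h
  · exact (_root_.continuous_apply _).comp continuous_subtype_val
  · exact continuous_const

/-- A map into a realization that meets only finitely many vertices is continuous as soon as its
barycentric coordinates are. -/
theorem continuous_of_support_subset {T : Type*} [TopologicalSpace T] {f : T → Realization K}
    (S : Finset V) (hS : ∀ t, (f t).1.support ⊆ S) (hf : ∀ v, Continuous fun t => (f t).1 v) :
    Continuous f := by
  classical
  let ι := {σ : K.faces // (σ : Finset V) ⊆ S}
  have : Finite ι := by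
    refine Finite.of_injective (β := S.powerset) (fun σ => ⟨σ.1.1, Finset.mem_powerset.2 σ.2⟩) ?_
    intro σ τ h
    exact Subtype.ext (Subtype.ext (Subtype.mk.inj h))
  -- Finitely many closed sets cover `T`; on each, `f` factors through one closed simplex.
  let C : ι → Set T := fun σ => {t | ∀ v ∉ (σ.1 : Finset V), (f t).1 v = 0}
  refine (locallyFinite_of_finite C).continuous ?_ ?_ ?_
  · refine Set.eq_univ_of_forall fun t => Set.mem_iUnion.2 ⟨⟨⟨_, (f t).2.2.2⟩, hS t⟩, ?_⟩
    exact fun v hv => Finsupp.notMem_support_iff.1 hv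
  · intro σ
    simp only [C, Set.ofPred_forall]
    exact isClosed_iInter fun v => isClosed_iInter fun _ => isClosed_eq (hf v) continuous_const
  · intro σ
    rw [continuousOn_iff_continuous_domRestrict]
    have key (t : C σ) : (fun v : (σ.1 : Finset V) => (f t).1 v) ∈ stdSimplex ℝ (σ.1 : Finset V) := by
      refine ⟨fun v => (f t).2.1 v, ?_⟩
      refine (Finset.sum_coe_sort (σ.1 : Finset V) (fun v => (f t).1 v)).trans
        (Eq.trans ?_ (f t).2.2.1)
      refine (Finsupp.sum_of_support_subset _ (fun v hv => ?_) (fun _ r => r) (fun _ _ => rfl)).symm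
      by_contra h
      exact Finsupp.mem_support_iff.1 hv (t.2 v h)
    have : (C σ).domRestrict f = ofSimplex K σ.1 ∘ fun t => ⟨_, key t⟩ := by
      funext t
      refine Subtype.ext (Finsupp.ext fun v => ?_)
      simp only [Function.comp_apply, ofSimplex_apply, Set.domRestrict_apply]
      split_ifs with h
      · rfl
      · exact t.2 v h
    rw [this]
    exact (continuous_ofSimplex _).comp ((continuous_pi fun v : (σ.1 : Finset V) =>
      (hf v).comp continuous_subtype_val).subtype_mk key)

/-- The product of a realization with the unit interval carries the weak topology determined by the
products of the closed simplices with the unit interval. -/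
theorem continuous_prod_iff {T : Type*} [TopologicalSpace T] {f : Realization K × unitInterval → T} :
    Continuous f ↔ ∀ σ : K.faces,
      Continuous fun q : stdSimplex ℝ (σ : Finset V) × unitInterval => f (ofSimplex K σ q.1, q.2) := by
  refine ⟨fun h σ => h.comp ((continuous_ofSimplex σ).prodMap continuous_id), fun h => ?_⟩
  have hc (p : Realization K) : Continuous fun c => f (p, c) := by
    classical
    have hp : ∃ q, ofSimplex K ⟨_, p.2.2.2⟩ q = p := by
      refine ⟨⟨fun v => p.1 v, fun v => p.2.1 v, ?_⟩, ?_⟩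
      · exact (Finset.sum_coe_sort p.1.support p.1).trans p.2.2.1
      · refine Subtype.ext (Finsupp.ext fun v => ?_)
        rw [ofSimplex_apply]
        split_ifs with hv
        · rfl
        · exact (Finsupp.notMem_support_iff.1 hv).symm
    obtain ⟨q, hq⟩ := hp
    rw [← hq]
    exact (h _).comp (Continuous.prodMk_right q)
  -- Currying reduces the claim to maps out of the realization; uncurrying works because the
  -- interval is locally compact.
  let g : Realization K → C(unitInterval, T) := fun p => ⟨fun c => f (p, c), hc p⟩
  have hg : Continuous g := continuous_iff_forall_ofSimplex.2 fun σ =>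
    ContinuousMap.continuous_of_continuous_uncurry _ (h σ)
  exact ContinuousMap.continuous_uncurry_of_continuous ⟨g, hg⟩

/-- The map of realizations induced by an injective simplicial map. -/
noncomputable def map (φ : V ↪ W) (h : ∀ σ ∈ K.faces, σ.map φ ∈ L.faces) (p : Realization K) :
    Realization L :=
  ⟨p.1.embDomain φ, fun w => by
    by_cases hw : w ∈ Set.range φ
    · obtain ⟨v, rfl⟩ := hw
      rw [Finsupp.embDomain_apply_self]
      exact p.2.1 v
    · rw [Finsupp.embDomain_of_notMem_range _ _ _ hw], by
    rw [Finsupp.sum_embDomain]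
    exact p.2.2.1, by
    rw [Finsupp.support_embDomain]
    exact h _ p.2.2.2⟩

theorem continuous_map (φ : V ↪ W) (h : ∀ σ ∈ K.faces, σ.map φ ∈ L.faces) :
    Continuous (map φ h) := by
  refine continuous_iff_forall_ofSimplex.2 fun σ =>
    continuous_of_support_subset ((σ : Finset V).map φ) (fun q => ?_) fun w => ?_
  · simp only [map, Function.comp_apply, Finsupp.support_embDomain]
    exact Finset.map_subset_map.2 (support_ofSimplex_subset σ q)
  · simp only [map, Function.comp_apply]
    by_cases hw : w ∈ Set.range φ
    · obtain ⟨v, rfl⟩ := hw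
      simp only [Finsupp.embDomain_apply_self]
      exact (continuous_apply v).comp (continuous_ofSimplex σ)
    · simp only [Finsupp.embDomain_of_notMem_range _ _ _ hw]
      exact continuous_const

/-- An isomorphism of simplicial complexes induces a homeomorphism of realizations. -/
noncomputable def mapHomeomorph (e : V ≃ W) (h : ∀ σ ∈ K.faces, σ.map e.toEmbedding ∈ L.faces)
    (h' : ∀ σ ∈ L.faces, σ.map e.symm.toEmbedding ∈ K.faces) : Realization K ≃ₜ Realization L where
  toFun := map e.toEmbedding h
  invFun := map e.symm.toEmbedding h'
  left_inv p := by
    refine Subtype.ext (Finsupp.ext fun v => ?_)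
    refine Eq.trans (congrArg _ (e.symm_apply_apply v).symm) ((Finsupp.embDomain_apply_self
      e.symm.toEmbedding (p.1.embDomain e.toEmbedding) (e v)).trans ?_)
    exact Finsupp.embDomain_apply_self e.toEmbedding p.1 v
  right_inv p := by
    refine Subtype.ext (Finsupp.ext fun v => ?_)
    refine Eq.trans (congrArg _ (e.apply_symm_apply v).symm) ((Finsupp.embDomain_apply_self
      e.toEmbedding (p.1.embDomain e.symm.toEmbedding) (e.symm v)).trans ?_)
    exact Finsupp.embDomain_apply_self e.symm.toEmbedding p.1 v
  continuous_toFun := continuous_map _ _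
  continuous_invFun := continuous_map _ _

/-- The point of a realization obtained by rescaling nonnegative weights supported on a simplex. -/
noncomputable def normalize (K : PreAbstractSimplicialComplex V) (t : V →₀ ℝ) (h0 : ∀ v, 0 ≤ t v)
    (ht : t.support ∈ K.faces) : Realization K :=
  have hpos : 0 < t.sum fun _ r => r := by
    refine Finset.sum_pos (fun v hv => (h0 v).lt_of_ne' (Finsupp.mem_support_iff.1 hv)) ?_
    exact (K.isRelLowerSet_faces ht).1
  ⟨(t.sum fun _ r => r)⁻¹ • t, fun v => mul_nonneg (inv_nonneg.2 hpos.le) (h0 v), by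
    rw [Finsupp.sum_smul_index fun _ => rfl, ← Finsupp.mul_sum, inv_mul_cancel₀ hpos.ne'], by
    rwa [Finsupp.support_smul_eq (inv_ne_zero hpos.ne')]⟩

theorem normalize_val (t : V →₀ ℝ) (h0 : ∀ v, 0 ≤ t v) (ht : t.support ∈ K.faces) :
    (normalize K t h0 ht).1 = (t.sum fun _ r => r)⁻¹ • t := rfl

theorem normalize_eq {t : V →₀ ℝ} (h0 : ∀ v, 0 ≤ t v) (ht : t.support ∈ K.faces)
    (p : Realization K) (hp : t = p.1) : normalize K t h0 ht = p := by
  subst hp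
  refine Subtype.ext ?_
  rw [normalize_val, p.2.2.1, inv_one, one_smul]

theorem continuous_normalize {T : Type*} [TopologicalSpace T] {t : T → V →₀ ℝ}
    (h0 : ∀ s v, 0 ≤ t s v) (ht : ∀ s, (t s).support ∈ K.faces) (S : Finset V)
    (hS : ∀ s, (t s).support ⊆ S) (hc : ∀ v, Continuous fun s => t s v) :
    Continuous fun s => normalize K (t s) (h0 s) (ht s) := by
  have hsum (s : T) : ((t s).sum fun _ r => r) = ∑ v ∈ S, t s v :=
    Finsupp.sum_of_support_subset _ (hS s) _ fun _ _ => rfl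
  have hne (s : T) : ∑ v ∈ S, t s v ≠ 0 := by
    intro h
    have h1 := (normalize K (t s) (h0 s) (ht s)).2.2.1
    rw [normalize_val, hsum, h, inv_zero, zero_smul, Finsupp.sum_zero_index] at h1
    exact zero_ne_one h1
  refine continuous_of_support_subset S (fun s => ?_) fun v => ?_
  · exact Finsupp.support_smul.trans (hS s)
  · simp only [normalize_val, hsum, Finsupp.smul_apply, smul_eq_mul]
    exact ((continuous_finsetSum S fun v _ => hc v).inv₀ hne).mul (hc v)

end Realization

/-! ### Superlevel sets and their lengths -/

section Layer

variable {A : Type*} {X : Type*}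

/-- For weights `u` supported in `S`, the length of the set of levels `s < c` at which the
superlevel set `{a | s < u a}` is equal to `σ`. -/
noncomputable def layer [DecidableEq A] (S : Finset A) (u : A → ℝ≥0) (c : ℝ≥0) (σ : Finset A) : ℝ≥0 :=
  -- By truncated subtraction the first difference is the minimum of `c` and the values of `u` on
  -- `σ`, also for empty `σ`.
  c - σ.sup (fun a => c - u a) - (S \ σ).sup u

/-- The levels of `u` below `c`, distributed over the vertices chosen for their superlevel sets. -/
noncomputable def layerSum [DecidableEq A] [DecidableEq X] (x : Finset A → X) (S : Finset A)
    (u : A → ℝ≥0) (c : ℝ≥0) (z : X) : ℝ≥0 :=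
  ∑ σ ∈ S.powerset with σ.Nonempty ∧ x σ = z, layer S u c σ

variable [DecidableEq A] [DecidableEq X] {S : Finset A} {u : A → ℝ≥0} {c : ℝ≥0} {σ : Finset A}

theorem layer_pos_iff : 0 < layer S u c σ ↔ σ.sup (fun a => c - u a) + (S \ σ).sup u < c := by
  rw [layer, tsub_pos_iff_lt, lt_tsub_iff_left]

theorem layer_zero : layer S u 0 σ = 0 := by
  simp [layer]

/-- Some level `s` has `u b ≤ s < u a`. -/
theorem lt_of_layer_pos (h : 0 < layer S u c σ) {a b : A} (ha : a ∈ σ) (hb : b ∈ S) (hbσ : b ∉ σ) :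
    u b < u a := by
  have h1 := Finset.le_sup (f := fun a => c - u a) ha
  have h2 := Finset.le_sup (f := u) (Finset.mem_sdiff.2 ⟨hb, hbσ⟩)
  have h3 := (add_le_add h1 h2).trans_lt (layer_pos_iff.1 h)
  have h4 : c - u a < c - u b := lt_tsub_iff_right.2 h3
  exact lt_of_not_ge fun h5 => h4.not_ge (tsub_le_tsub_left h5 c)

theorem lt_cut_of_layer_pos (h : 0 < layer S u c σ) {b : A} (hb : b ∈ S) (hbσ : b ∉ σ) :
    u b < c :=
  (Finset.le_sup (f := u) (Finset.mem_sdiff.2 ⟨hb, hbσ⟩)).trans_lt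
    (le_add_self.trans_lt (layer_pos_iff.1 h))

theorem pos_of_layer_pos (h : 0 < layer S u c σ) {a : A} (ha : a ∈ σ) : 0 < u a := by
  have h1 := (Finset.le_sup (f := fun a => c - u a) ha).trans_lt
    (le_self_add.trans_lt (layer_pos_iff.1 h))
  refine pos_iff_ne_zero.2 fun h0 => ?_
  simp [h0] at h1

/-- Levels just below the maximum see exactly the maximizers. This keeps the pushed vector nonzero
when the cut removes all `A`-mass. -/
theorem layer_argmax_pos {a : A} (ha : 0 < u a) (hmax : ∀ b ∈ S, u b ≤ u a) (hc : u a ≤ c) :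
    0 < layer S u c {b ∈ S | u b = u a} := by
  rw [layer_pos_iff]
  have h1 : ({b ∈ S | u b = u a} : Finset A).sup (fun b => c - u b) ≤ c - u a :=
    Finset.sup_le fun b hb => (congrArg (c - ·) (Finset.mem_filter.1 hb).2).le
  have h2 : (S \ {b ∈ S | u b = u a}).sup u < u a := by
    refine (Finset.sup_lt_iff (by simpa using ha)).2 fun b hb => ?_
    simp only [Finset.mem_sdiff, Finset.mem_filter, not_and] at hb
    exact (hmax b hb.1).lt_of_ne (hb.2 hb.1)
  calc _ < (c - u a) + u a := add_lt_add_of_le_of_lt h1 h2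
    _ = c := tsub_add_cancel_of_le hc

/-- Zero weights do not affect the supremum. This allows replacing the support, which jumps within a
closed simplex, by a fixed vertex set. -/
theorem layer_eq_of_subset {T : Finset A} (hST : S ⊆ T) (hu : ∀ a ∉ S, u a = 0) :
    layer T u c σ = layer S u c σ := by
  rw [layer, layer]
  congr 1
  refine le_antisymm (Finset.sup_le fun a ha => ?_)
    (Finset.sup_mono (Finset.sdiff_subset_sdiff hST le_rfl))
  by_cases haS : a ∈ S
  · exact Finset.le_sup (Finset.mem_sdiff.2 ⟨haS, (Finset.mem_sdiff.1 ha).2⟩)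
  · simp [hu a haS]

theorem layerSum_eq_of_subset (x : Finset A → X) {T : Finset A} (hST : S ⊆ T)
    (hu : ∀ a ∉ S, u a = 0) (z : X) : layerSum x T u c z = layerSum x S u c z := by
  simp only [layerSum, layer_eq_of_subset hST hu]
  refine (Finset.sum_subset ?_ fun σ hσ hσ' => ?_).symm
  · exact Finset.filter_subset_filter _ (Finset.powerset_mono.2 hST)
  · by_contra h
    rw [Finset.mem_filter] at hσ hσ'
    refine hσ' ⟨Finset.mem_powerset.2 fun a ha => ?_, hσ.2⟩
    by_contra haS
    exact (pos_of_layer_pos (pos_iff_ne_zero.2 h) ha).ne' (hu a haS)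

theorem exists_of_layerSum_ne_zero {x : Finset A → X} {z : X} (h : layerSum x S u c z ≠ 0) :
    ∃ σ ⊆ S, σ.Nonempty ∧ x σ = z ∧ 0 < layer S u c σ := by
  obtain ⟨σ, hσ, h0⟩ := Finset.exists_ne_zero_of_sum_ne_zero h
  rw [Finset.mem_filter, Finset.mem_powerset] at hσ
  exact ⟨σ, hσ.1, hσ.2.1, hσ.2.2, pos_iff_ne_zero.2 h0⟩

theorem layerSum_pos (x : Finset A → X) (hσ : σ ⊆ S) (hne : σ.Nonempty) (h : 0 < layer S u c σ) :
    0 < layerSum x S u c (x σ) :=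
  h.trans_le (Finset.single_le_sum (f := layer S u c) (fun _ _ => zero_le)
    (Finset.mem_filter.2 ⟨Finset.mem_powerset.2 hσ, hne, rfl⟩))

theorem layerSum_zero (x : Finset A → X) (z : X) : layerSum x S u 0 z = 0 := by
  simp [layerSum, layer_zero]

theorem layerSum_empty (x : Finset A → X) (z : X) : layerSum x ∅ u c z = 0 := by
  by_contra h
  obtain ⟨σ, h1, h2, -⟩ := exists_of_layerSum_ne_zero h
  exact h2.ne_empty (Finset.subset_empty.1 h1)

theorem continuous_layerSum {T : Type*} [TopologicalSpace T] (x : Finset A → X) (S : Finset A)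
    {u : T → A → ℝ≥0} {c : T → ℝ≥0} (hu : ∀ a, Continuous fun t => u t a) (hc : Continuous c)
    (z : X) : Continuous fun t => layerSum x S (u t) (c t) z := by
  refine continuous_finsetSum _ fun σ _ => (hc.sub ?_).sub ?_
  · exact Continuous.finset_sup_apply fun a _ => hc.sub (hu a)
  · exact Continuous.finset_sup_apply fun a _ => hu a

end Layer

/-! ### The joint complex -/

section JointComplex

variable {A : Type u} {X : Type v}

/-- The complex on the disjoint union of `A` and `X` whose simplices are the disjoint unions
`σ ⊔ τ` with `σ × τ ⊆ R`, where each of `σ` and `τ` is empty or a simplex of the respective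
Dowker complex. -/
def jointComplex (R : SetRel A X) : PreAbstractSimplicialComplex (A ⊕ X) where
  faces := {ρ | ρ.Nonempty ∧ (∃ x, ∀ a, .inl a ∈ ρ → (a, x) ∈ R) ∧
    (∃ a, ∀ x, .inr x ∈ ρ → (a, x) ∈ R) ∧ ∀ a x, .inl a ∈ ρ → .inr x ∈ ρ → (a, x) ∈ R}
  isRelLowerSet_faces := by
    rintro ρ ⟨hρ, ⟨x, hx⟩, ⟨a, ha⟩, hax⟩
    exact ⟨hρ, fun τ hτ hne => ⟨hne, ⟨x, fun a h => hx a (hτ h)⟩,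
      ⟨a, fun x h => ha x (hτ h)⟩, fun a x h h' => hax a x (hτ h) (hτ h')⟩⟩

/-- The weights of a vector on its `A`-coordinates. -/
noncomputable def leftWeight (p : A ⊕ X →₀ ℝ) (a : A) : ℝ≥0 := (p (.inl a)).toNNReal

theorem leftWeight_eq_zero {p : A ⊕ X →₀ ℝ} {S : Finset A} (hS : p.support.toLeft ⊆ S) {a : A}
    (ha : a ∉ S) : leftWeight p a = 0 := by
  have : a ∉ p.support.toLeft := fun h => ha (hS h)
  rw [Finset.mem_toLeft, Finsupp.notMem_support_iff] at this
  rw [leftWeight, this, Real.toNNReal_zero]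

theorem map_inr_mem_jointComplex (R : SetRel A X) {τ : Finset X}
    (hτ : τ ∈ (dowkerComplex R.inv).faces) :
    τ.map Function.Embedding.inr ∈ (jointComplex R).faces := by
  obtain ⟨⟨z, hz⟩, a, ha⟩ := hτ
  refine ⟨⟨.inr z, Finset.mem_map_of_mem _ hz⟩, ⟨z, fun a h => ?_⟩, ⟨a, fun z h => ?_⟩,
    fun a z h => ?_⟩
  · simp at h
  · exact ha z (by simpa using h)
  · simp at h

/-- The inclusion of the Dowker complex with base `X` into the joint complex. -/
noncomputable def inclRight (R : SetRel A X) :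
    Realization (dowkerComplex R.inv) → Realization (jointComplex R) :=
  Realization.map Function.Embedding.inr fun _ => map_inr_mem_jointComplex R

theorem inclRight_inl {R : SetRel A X} (p : Realization (dowkerComplex R.inv)) (a : A) :
    (inclRight R p).1 (.inl a) = 0 :=
  Finsupp.embDomain_of_notMem_range _ _ _ (by simp)

theorem inclRight_inr {R : SetRel A X} (p : Realization (dowkerComplex R.inv)) (z : X) :
    (inclRight R p).1 (.inr z) = p.1 z :=
  Finsupp.embDomain_apply_self Function.Embedding.inr _ z

/-- The restriction to `X` of a point of the joint complex supported there. -/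
noncomputable def restrictRight {R : SetRel A X} (p : Realization (jointComplex R))
    (hp : ∀ a, p.1 (.inl a) = 0) :
    Realization (dowkerComplex R.inv) :=
  have hmap : (p.1.comapDomain Sum.inr Sum.inr_injective.injOn).embDomain Function.Embedding.inr
      = p.1 := by
    ext (a | z)
    · exact (Finsupp.embDomain_of_notMem_range _ _ _ (by simp)).trans (hp a).symm
    · exact Finsupp.embDomain_apply_self Function.Embedding.inr _ z
  ⟨p.1.comapDomain Sum.inr Sum.inr_injective.injOn, fun z => p.2.1 _, by
    refine Eq.trans ?_ p.2.2.1
    conv_rhs => rw [← hmap]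
    rw [Finsupp.sum_embDomain], by
    obtain ⟨hne, -, ⟨a, ha⟩, -⟩ := p.2.2.2
    refine ⟨?_, a, fun z hz => ha z ?_⟩
    · rw [← hmap, Finsupp.support_embDomain, Finset.map_nonempty] at hne
      exact hne
    · simpa using hz⟩

/-! ### Pushing mass from `A` to `X` -/

variable [DecidableEq A] [DecidableEq X]

/-- Move the mass of `p` lying on `A` below the level `c` to `X`, along the superlevel sets of
the `A`-coordinates. -/
noncomputable def pushVector (x : Finset A → X) (p : A ⊕ X →₀ ℝ) (c : ℝ≥0) : A ⊕ X →₀ ℝ :=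
  Finsupp.onFinset
    (p.support.toLeft.disjSum (p.support.toRight ∪ p.support.toLeft.powerset.image x))
    (Sum.elim (fun a => ((leftWeight p a - c : ℝ≥0) : ℝ))
      fun z => p (.inr z) + layerSum x p.support.toLeft (leftWeight p) c z) (by
    rintro (a | z) h
    · rw [Finset.inl_mem_disjSum]
      by_contra ha
      simp [leftWeight_eq_zero le_rfl ha] at h
    · rw [Finset.inr_mem_disjSum, Finset.mem_union, Finset.mem_toRight, Finsupp.mem_support_iff]
      by_contra! hz
      rw [Sum.elim_inr, hz.1, zero_add, NNReal.coe_ne_zero] at h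
      obtain ⟨σ, hσ, -, rfl, -⟩ := exists_of_layerSum_ne_zero h
      exact hz.2 (Finset.mem_image_of_mem _ (Finset.mem_powerset.2 hσ)))

theorem pushVector_inl (x : Finset A → X) (p : A ⊕ X →₀ ℝ) (c : ℝ≥0) (a : A) :
    pushVector x p c (.inl a) = ((leftWeight p a - c : ℝ≥0) : ℝ) := rfl

theorem pushVector_inr (x : Finset A → X) (p : A ⊕ X →₀ ℝ) (c : ℝ≥0) (z : X) :
    pushVector x p c (.inr z) =
      p (.inr z) + layerSum x p.support.toLeft (leftWeight p) c z := rfl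

theorem pushVector_inr_of_subset (x : Finset A → X) (p : A ⊕ X →₀ ℝ) (c : ℝ≥0) (z : X)
    {S : Finset A} (hS : p.support.toLeft ⊆ S) :
    pushVector x p c (.inr z) = p (.inr z) + layerSum x S (leftWeight p) c z := by
  rw [pushVector_inr, layerSum_eq_of_subset x hS fun a => leftWeight_eq_zero le_rfl]

theorem support_pushVector_subset (x : Finset A → X) (p : A ⊕ X →₀ ℝ) (c : ℝ≥0)
    {ρ : Finset (A ⊕ X)} (hρ : p.support ⊆ ρ) :
    (pushVector x p c).support ⊆ ρ.toLeft.disjSum (ρ.toRight ∪ ρ.toLeft.powerset.image x) :=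
  Finsupp.support_onFinset_subset.trans (Finset.disjSum_mono (Finset.toLeft_monotone hρ)
    (Finset.union_subset_union (Finset.toRight_monotone hρ) (Finset.image_subset_image
      (Finset.powerset_mono.2 (Finset.toLeft_monotone hρ)))))

theorem pushVector_nonneg {x : Finset A → X} {p : A ⊕ X →₀ ℝ} (hp : ∀ v, 0 ≤ p v) (c : ℝ≥0) :
    ∀ v, 0 ≤ pushVector x p c v := by
  rintro (a | z)
  · exact NNReal.coe_nonneg _
  · exact add_nonneg (hp _) (NNReal.coe_nonneg _)

theorem pushVector_zero {x : Finset A → X} {p : A ⊕ X →₀ ℝ} (hp : ∀ v, 0 ≤ p v) :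
    pushVector x p 0 = p := by
  ext (a | z)
  · rw [pushVector_inl, tsub_zero, leftWeight, Real.coe_toNNReal _ (hp _)]
  · rw [pushVector_inr, layerSum_zero, NNReal.coe_zero, add_zero]

theorem pushVector_of_toLeft_eq_empty {x : Finset A → X} {p : A ⊕ X →₀ ℝ}
    (hp : p.support.toLeft = ∅) (c : ℝ≥0) : pushVector x p c = p := by
  ext (a | z)
  · have ha : a ∉ p.support.toLeft := by simp [hp]
    rw [pushVector_inl, leftWeight_eq_zero le_rfl ha, zero_tsub, NNReal.coe_zero]
    rw [Finset.mem_toLeft, Finsupp.notMem_support_iff] at ha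
    exact ha.symm
  · rw [pushVector_inr, hp, layerSum_empty, NNReal.coe_zero, add_zero]

theorem support_pushVector_mem_faces {R : SetRel A X} {x : Finset A → X}
    (hx : ∀ σ ∈ (dowkerComplex R).faces, ∀ a ∈ σ, (a, x σ) ∈ R) {p : A ⊕ X →₀ ℝ}
    (h0 : ∀ v, 0 ≤ p v) (hp : p.support ∈ (jointComplex R).faces) (c : ℝ≥0) :
    (pushVector x p c).support ∈ (jointComplex R).faces := by
  obtain ⟨hne, ⟨z₀, hz₀⟩, ⟨a₀, ha₀⟩, hR⟩ := hp
  set S := p.support.toLeft with hS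
  have hleft {a : A} (ha : Sum.inl a ∈ (pushVector x p c).support) : c < leftWeight p a := by
    rw [Finsupp.mem_support_iff, pushVector_inl, NNReal.coe_ne_zero] at ha
    exact tsub_pos_iff_lt.1 (pos_iff_ne_zero.2 ha)
  have hleft_mem {a : A} (ha : 0 < leftWeight p a) : a ∈ S := by
    by_contra h
    exact ha.ne' (leftWeight_eq_zero le_rfl h)
  have hright {z : X} (hz : Sum.inr z ∈ (pushVector x p c).support) :
      Sum.inr z ∈ p.support ∨
        ∃ σ ⊆ S, σ.Nonempty ∧ x σ = z ∧ 0 < layer S (leftWeight p) c σ := by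
    rw [Finsupp.mem_support_iff, pushVector_inr] at hz
    by_cases h : p (.inr z) = 0
    · rw [h, zero_add, NNReal.coe_ne_zero] at hz
      exact .inr (exists_of_layerSum_ne_zero hz)
    · exact .inl (Finsupp.mem_support_iff.2 h)
  have hxσ {σ : Finset A} (hσ : σ ⊆ S) {a : A} (ha : a ∈ σ) : (a, x σ) ∈ R :=
    hx σ ⟨⟨a, ha⟩, z₀, fun b hb => hz₀ b (Finset.mem_toLeft.1 (hσ hb))⟩ a ha
  have hmax : S.Nonempty → ∃ a ∈ S, ∀ b ∈ S, leftWeight p b ≤ leftWeight p a :=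
    fun h => S.exists_max_image (leftWeight p) h
  refine ⟨?_, ⟨z₀, fun a ha => hz₀ a ?_⟩, ?_, fun a z ha hz => ?_⟩
  · rcases S.eq_empty_or_nonempty with h | h
    · rwa [pushVector_of_toLeft_eq_empty h]
    · obtain ⟨a, ha, hmax⟩ := hmax h
      have hpos : 0 < leftWeight p a := Real.toNNReal_pos.2 ((h0 _).lt_of_ne'
        (Finsupp.mem_support_iff.1 (Finset.mem_toLeft.1 ha)))
      rcases lt_or_ge c (leftWeight p a) with hc | hc
      · refine ⟨.inl a, ?_⟩
        rw [Finsupp.mem_support_iff, pushVector_inl, NNReal.coe_ne_zero]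
        exact (tsub_pos_iff_lt.2 hc).ne'
      · refine ⟨.inr (x {b ∈ S | leftWeight p b = leftWeight p a}), ?_⟩
        rw [Finsupp.mem_support_iff, pushVector_inr]
        refine (add_pos_of_nonneg_of_pos (h0 _) (NNReal.coe_pos.2 ?_)).ne'
        exact layerSum_pos x (Finset.filter_subset _ _) ⟨a, Finset.mem_filter.2 ⟨ha, rfl⟩⟩
          (layer_argmax_pos hpos hmax hc)
  · exact Finset.mem_toLeft.1 (hleft_mem ((zero_le).trans_lt (hleft ha)))
  · rcases S.eq_empty_or_nonempty with h | h
    · rw [pushVector_of_toLeft_eq_empty h]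
      exact ⟨a₀, ha₀⟩
    · obtain ⟨a, ha, hmax⟩ := hmax h
      -- A maximizer of the `A`-weights is a common witness: it lies in every superlevel set that
      -- receives mass.
      refine ⟨a, fun z hz => ?_⟩
      rcases hright hz with hz | ⟨σ, hσ, ⟨b, hb⟩, rfl, hpos⟩
      · exact hR a z (Finset.mem_toLeft.1 ha) hz
      · refine hxσ hσ ?_
        by_contra haσ
        exact (lt_of_layer_pos hpos hb ha haσ).not_ge (hmax b (hσ hb))
  · have haS := hleft_mem ((zero_le).trans_lt (hleft ha))
    rcases hright hz with hz | ⟨σ, hσ, -, rfl, hpos⟩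
    · exact hR a z (Finset.mem_toLeft.1 haS) hz
    · refine hxσ hσ ?_
      by_contra haσ
      exact (lt_cut_of_layer_pos hpos haS haσ).not_gt (hleft ha)

/-- The homotopy pushing the realization of the joint complex into its `X`-part. -/
noncomputable def push {R : SetRel A X} {x : Finset A → X}
    (hx : ∀ σ ∈ (dowkerComplex R).faces, ∀ a ∈ σ, (a, x σ) ∈ R)
    (q : Realization (jointComplex R) × unitInterval) : Realization (jointComplex R) :=
  Realization.normalize _ (pushVector x q.1.1 (unitInterval.toNNReal q.2))
    (pushVector_nonneg q.1.2.1 _) (support_pushVector_mem_faces hx q.1.2.1 q.1.2.2.2 _)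

variable {R : SetRel A X} {x : Finset A → X}
    (hx : ∀ σ ∈ (dowkerComplex R).faces, ∀ a ∈ σ, (a, x σ) ∈ R)

theorem support_push_subset (q : Realization (jointComplex R) × unitInterval)
    {ρ : Finset (A ⊕ X)} (hρ : q.1.1.support ⊆ ρ) :
    (push hx q).1.support ⊆ ρ.toLeft.disjSum (ρ.toRight ∪ ρ.toLeft.powerset.image x) :=
  Finsupp.support_smul.trans (support_pushVector_subset _ _ _ hρ)

theorem continuous_pushVector {T : Type*} [TopologicalSpace T] (x : Finset A → X)
    {p : T → A ⊕ X →₀ ℝ} {c : T → ℝ≥0} (S : Finset A) (hS : ∀ t, (p t).support.toLeft ⊆ S)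
    (hp : ∀ v, Continuous fun t => p t v) (hc : Continuous c) (v : A ⊕ X) :
    Continuous fun t => pushVector x (p t) (c t) v := by
  have hweight (a : A) : Continuous fun t => leftWeight (p t) a :=
    continuous_real_toNNReal.comp (hp (.inl a))
  rcases v with a | z
  · exact NNReal.continuous_coe.comp ((hweight a).sub hc)
  · simp only [pushVector_inr_of_subset x _ _ z (hS _)]
    exact (hp _).add (NNReal.continuous_coe.comp (continuous_layerSum x S hweight hc z))

theorem continuous_push : Continuous (push hx) := by
  refine Realization.continuous_prod_iff.2 fun σ => ?_
  have hS (q : stdSimplex ℝ (σ : Finset (A ⊕ X)) × unitInterval) :=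
    Realization.support_ofSimplex_subset σ q.1
  refine Realization.continuous_normalize (K := jointComplex R)
    (t := fun q : stdSimplex ℝ (σ : Finset (A ⊕ X)) × unitInterval =>
      pushVector x (Realization.ofSimplex _ σ q.1).1 (unitInterval.toNNReal q.2))
    _ _ _ (fun q => support_pushVector_subset _ _ _ (hS q))
    (continuous_pushVector x (σ : Finset (A ⊕ X)).toLeft
      (fun q => Finset.toLeft_monotone (hS q)) (fun v => ?_)
      (unitInterval.toNNReal_continuous.comp continuous_snd))
  exact (Realization.continuous_apply v).comp
    ((Realization.continuous_ofSimplex σ).comp continuous_fst)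

theorem push_zero (p : Realization (jointComplex R)) : push hx (p, 0) = p :=
  Realization.normalize_eq _ _ p (by
    rw [show unitInterval.toNNReal (p, (0 : unitInterval)).2 = 0 from rfl]
    exact pushVector_zero p.2.1)

/-- The homotopy fixes the `X`-part pointwise, so the retraction is strict there. -/
theorem push_of_toLeft_eq_empty (p : Realization (jointComplex R)) (hp : p.1.support.toLeft = ∅)
    (c : unitInterval) : push hx (p, c) = p :=
  Realization.normalize_eq _ _ p (pushVector_of_toLeft_eq_empty hp _)

theorem Realization.apply_le_one {V : Type*} {K : PreAbstractSimplicialComplex V}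
    (p : Realization K) (v : V) : p.1 v ≤ 1 := by
  by_cases hv : v ∈ p.1.support
  · exact (Finset.single_le_sum (f := p.1) (fun w _ => p.2.1 w) hv).trans_eq p.2.2.1
  · exact (Finsupp.notMem_support_iff.1 hv).trans_le zero_le_one

theorem push_one_inl (p : Realization (jointComplex R)) (a : A) :
    (push hx (p, 1)).1 (.inl a) = 0 := by
  have h : pushVector x p.1 1 (.inl a) = 0 := by
    rw [pushVector_inl, NNReal.coe_eq_zero, tsub_eq_zero_iff_le, leftWeight,
      Real.toNNReal_le_one]
    exact p.apply_le_one _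
  exact mul_eq_zero_of_right _ h

/-- The Dowker complex with base `X` is a deformation retract of the joint complex. -/
theorem nonempty_homotopyEquiv_jointComplex
    (hx : ∀ σ ∈ (dowkerComplex R).faces, ∀ a ∈ σ, (a, x σ) ∈ R) :
    Nonempty (Realization (dowkerComplex R.inv) ≃ₕ Realization (jointComplex R)) := by
  let r (p : Realization (jointComplex R)) : Realization (dowkerComplex R.inv) :=
    restrictRight (push hx (p, 1)) (push_one_inl hx p)
  have hpush1 : Continuous fun p => push hx (p, 1) :=
    (continuous_push hx).comp (Continuous.prodMk_left 1)
  -- Each closed simplex is sent into finitely many vertices of `X`, so coordinatewise continuity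
  -- suffices.
  have hr : Continuous r := by
    refine Realization.continuous_iff_forall_ofSimplex.2 fun σ => ?_
    refine Realization.continuous_of_support_subset
      ((σ : Finset (A ⊕ X)).toRight ∪ (σ : Finset (A ⊕ X)).toLeft.powerset.image x)
      (fun q z hz => ?_) fun z => ?_
    · refine Finset.inr_mem_disjSum.1 (support_push_subset hx (Realization.ofSimplex _ σ q, 1)
        (Realization.support_ofSimplex_subset σ q) ?_)
      rw [Finsupp.mem_support_iff] at hz ⊢
      exact hz
    · exact (Realization.continuous_apply (.inr z)).comp
        (hpush1.comp (Realization.continuous_ofSimplex σ))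
  have hincl : Continuous (inclRight R) := Realization.continuous_map _ _
  refine ⟨⟨⟨inclRight R, hincl⟩, ⟨r, hr⟩, ?_, ?_⟩⟩
  · convert ContinuousMap.Homotopic.refl _
    ext1 p
    refine Subtype.ext (Finsupp.ext fun z => ?_)
    have hp : (inclRight R p).1.support.toLeft = ∅ := by
      ext a
      simp [inclRight_inl]
    have : (push hx (inclRight R p, 1)).1 (.inr z) = p.1 z := by
      rw [push_of_toLeft_eq_empty hx _ hp, inclRight_inr]
    exact this.symm
  · refine ContinuousMap.Homotopic.symm ⟨⟨⟨fun q => push hx (q.2, q.1),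
      (continuous_push hx).comp continuous_swap⟩, push_zero hx, fun p => ?_⟩⟩
    refine Subtype.ext (Finsupp.ext ?_)
    rintro (a | z)
    · exact (push_one_inl hx p a).trans (inclRight_inl _ a).symm
    · exact (inclRight_inr (r p) z).symm

end JointComplex

/-! ### Choice of witnesses and the symmetric conclusion -/

theorem nonempty_dowkerComplex_homotopyEquiv_jointComplex {A : Type u} {X : Type v} [Nonempty X]
    (R : SetRel A X) :
    Nonempty (Realization (dowkerComplex R.inv) ≃ₕ Realization (jointComplex R)) := by
  classical
  have h (σ : Finset A) : ∃ x, σ ∈ (dowkerComplex R).faces → ∀ a ∈ σ, (a, x) ∈ R := by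
    by_cases hσ : σ ∈ (dowkerComplex R).faces
    · obtain ⟨x, hx⟩ := hσ.2
      exact ⟨x, fun _ => hx⟩
    -- The value off the simplices is immaterial.
    · exact ⟨Classical.arbitrary X, fun h => absurd h hσ⟩
  choose x hx using h
  exact nonempty_homotopyEquiv_jointComplex hx

theorem map_swap_mem_jointComplex {A : Type u} {X : Type v} (R : SetRel A X) {σ : Finset (A ⊕ X)}
    (hσ : σ ∈ (jointComplex R).faces) :
    σ.map (Equiv.sumComm A X).toEmbedding ∈ (jointComplex R.inv).faces := by
  obtain ⟨hne, ⟨x, hx⟩, ⟨a, ha⟩, hax⟩ := hσ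
  exact ⟨hne.map, ⟨a, fun x h => ha x (by simpa using h)⟩, ⟨x, fun a h => hx a (by simpa using h)⟩,
    fun x a h h' => hax a x (by simpa using h') (by simpa using h)⟩

theorem isEmpty_realization_dowkerComplex {A : Type u} {X : Type v} (R : SetRel A X)
    (h : IsEmpty A ∨ IsEmpty X) : IsEmpty (Realization (dowkerComplex R)) := by
  refine ⟨fun p => ?_⟩
  obtain ⟨⟨a, -⟩, x, -⟩ := p.2.2.2
  exact h.elim (fun h => h.false a) fun h => h.false x

theorem theorem3p2 {A : Type u} {X : Type v} (R : SetRel A X) :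
    Nonempty (Realization (dowkerComplex R) ≃ₕ Realization (dowkerComplex R.inv)) := by
  -- Choosing witnesses on both sides needs both sets nonempty; otherwise both realizations are
  -- empty.
  by_cases h : IsEmpty A ∨ IsEmpty X
  · have := isEmpty_realization_dowkerComplex R h
    have := isEmpty_realization_dowkerComplex R.inv h.symm
    exact ⟨(Homeomorph.empty).toHomotopyEquiv⟩
  · simp only [not_or, not_isEmpty_iff] at h
    have := h.1
    have := h.2
    obtain ⟨e⟩ := nonempty_dowkerComplex_homotopyEquiv_jointComplex R
    obtain ⟨e'⟩ := nonempty_dowkerComplex_homotopyEquiv_jointComplex R.inv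
    let s : Realization (jointComplex R) ≃ₜ Realization (jointComplex R.inv) :=
      Realization.mapHomeomorph (Equiv.sumComm A X) (fun _ => map_swap_mem_jointComplex R)
        fun _ => map_swap_mem_jointComplex R.inv
    exact ⟨(e'.trans s.symm.toHomotopyEquiv).trans e.symm⟩
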